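/- **Setting.** Let $D\subset\mathbb{R}^d$ ($d\in\{2,3\}$) be a bounded domain whose closure is triangulated by the meshes below. Let $\Gamma=\prod_{m=1}^\infty[-1,1]$ and $\pi=\prod_{m=1}^\infty\pi_m$ with symmetric Borel probability measures $\pi_m$ on $[-1,1]$. Let $a_0$ be measurable on $D$ with $0<a_0^{\min}\le a_0\le a_0^{\max}<\infty$ a.e., and let $a_m\in L^\infty(D)$ $(m\ge1)$ satisfy $\tau:=\frac1{a_0^{\min}}\sum_{m\ge1}\|a_m\|_{L^\infty(D)}<1$. Let $\mathbb{X}=H^1_0(D)$, $\mathbb{V}=L^2_\pi(\Gamma;\mathbb{X})$, $f\in L^2_\pi(\Gamma;H^{-1}(D))$ with $H^{-1}(D)=\mathbb{X}^*$, $F(v)=\int_\Gamma\langle f(\mathbf y),v(\mathbf y)\rangle\,d\pi(\mathbf y)$, and, for $u,v\in\mathbb{V}$, $$B_0(u,v)=\int_\Gamma\int_D a_0\nabla u\cdot\nabla v\,dx\,d\pi,\qquad B(u,v)=B_0(u,v)+\sum_{m=1}^\infty\int_\Gamma\int_D y_m a_m\nabla u\cdot\nabla v\,dx\,d\pi .$$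 For each $m$ let $(P^m_n)_{n\ge0}$ be orthonormal polynomials in $L^2_{\pi_m}(-1,1)$ with $\deg P^m_n=n$ and $P^m_0=1$ (they are assumed to exist, i.e. $\pi_m$ has infinite support). Let $\mathfrak{I}$ be the set of finitely supported multi-indices $\nu=(\nu_m)_{m\ge1}$, $\nu_m\in\mathbb{N}_0$, and $P_\nu(\mathbf y)=\prod_{m\in\operatorname{supp}\nu}P^m_{\nu_m}(y_m)$. For a finite set $\mathfrak{P}\subset\mathfrak{I}$ with $0\in\mathfrak{P}$ let $M_{\mathfrak{P}}:=\max\bigcup_{\nu\in\mathfrak{P}}\operatorname{supp}\nu$ (and $M_{\mathfrak{P}}:=0$ if $\mathfrak{P}=\{0\}$). The detail index set $\mathfrak{Q}(\mathfrak{P})$ consists of all $\mu\in\mathfrak{I}\setminus\mathfrak{P}$ of the form $\mu=\nu+\varepsilon_m$ or $\mu=\nu-\varepsilon_m$ with some $\nu\in\mathfrak{P}$ and some $m\in\{1,\dots,M_{\mathfrak{P}}+1\}$, where $\varepsilon_m$ is the $m$-th unit sequence. **Adaptive algorithm.** Let $(\mathcal{T}_\ell)_{\ell\ge0}$ be finite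 conforming triangulations of $\overline D$ into non-degenerate compact simplices such that every element of $\mathcal{T}_{\ell+1}$ is contained in an element of $\mathcal{T}_\ell$ (in particular, $\mathcal{T}_{\ell+1}$ may be obtained from $\mathcal{T}_\ell$ by newest vertex bisection driven by any set of marked vertices). Let $\mathfrak{P}_0=\{0\}$, $\mathfrak{Q}_\ell:=\mathfrak{Q}(\mathfrak{P}_\ell)$, let $\mathfrak{M}_\ell\subseteq\mathfrak{Q}_\ell$ be arbitrary sets of marked indices, and let $\mathfrak{P}_{\ell+1}=\mathfrak{P}_\ell\cup\mathfrak{M}_\ell$. Let $\mathbb{X}_\ell$ be the space of all $v\in H^1_0(D)$ that are affine on each element of $\mathcal{T}_\ell$, and $\mathbb{V}_\ell=\operatorname{span}\{vP_\nu: v\in\mathbb{X}_\ell,\ \nu\in\mathfrak{P}_\ell\}$. Let $u_\ell\in\mathbb{V}_\ell$ be the Galerkin solution, $B(u_\ell,v)=F(v)$ for all $v\in\mathbb{V}_\ell$. For $\nu\in\mathfrak{Q}_\ell$ let $e_\ell^\nu\in\mathbb{X}_\ell$ be the solution of $$B_0(e_\ell^\nu P_\nu,vP_\nu)=F(vP_\nu)-B(u_\ell,vP_\nu)\quad\text{for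 all }v\in\mathbb{X}_\ell .$$ Define $\eta_\ell(\nu):=\|a_0^{1/2}\nabla e_\ell^\nu\|_{L^2(D)}$ for $\nu\in\mathfrak{Q}_\ell$, and $\eta_\ell(\mathfrak{M}):=\big(\sum_{\nu\in\mathfrak{M}}\eta_\ell(\nu)^2\big)^{1/2}$ for $\mathfrak{M}\subseteq\mathfrak{Q}_\ell$. **Proposition.** Let $g_{\mathbb{P}}:\mathbb{R}_{\ge0}\to\mathbb{R}_{\ge0}$ be continuous with $g_{\mathbb{P}}(0)=0$. Suppose that there is a subsequence $\ell_0<\ell_1<\ell_2<\cdots$ such that $$\eta_{\ell_k}(\mu)\le g_{\mathbb{P}}\big(\eta_{\ell_k}(\mathfrak{M}_{\ell_k})\big)\quad\text{for all }k\in\mathbb{N}_0\text{ and all }\mu\in\mathfrak{Q}_{\ell_k}\setminus\mathfrak{M}_{\ell_k}.$$ Then the full sequence of parametric error estimates converges to zero: $\eta_\ell(\mathfrak{Q}_\ell)\to0$ as $\ell\to\infty$. -/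

import Mathlib

open MeasureTheory Filter Topology
open scoped ENNReal ContDiff

noncomputable section

namespace SGFEM

/-! ### The parameter domain and the orthonormal polynomials -/

/-- The parameter domain `Γ = ∏ [-1,1]`; the coordinates are numbered `0, 1, 2, …`. -/
abbrev Gam : Type := ℕ → Set.Icc (-1 : ℝ) 1

/-- Finitely supported multi-indices. -/
abbrev Idx : Type := ℕ →₀ ℕ

/-- A measure on `[-1,1]` is symmetric if it is invariant under `t ↦ -t`
(both sides are pushed forward to `ℝ`). -/
def IsSymmetric (ρ : Measure (Set.Icc (-1 : ℝ) 1)) : Prop :=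
  Measure.map (fun t : Set.Icc (-1 : ℝ) 1 => -(t : ℝ)) ρ =
    Measure.map (fun t : Set.Icc (-1 : ℝ) 1 => (t : ℝ)) ρ

/-- `p` is a sequence of orthonormal polynomials for `ρ`: `p n` has degree exactly `n`,
the `p n` are orthonormal in `L²(ρ)`, and `p 0 = 1`. -/
structure IsOrthonormalPolynomials (ρ : Measure (Set.Icc (-1 : ℝ) 1))
    (p : ℕ → Polynomial ℝ) : Prop where
  degree_eq : ∀ n : ℕ, (p n).degree = (n : WithBot ℕ)
  orthonormal : ∀ i j : ℕ,
    ∫ t, (p i).eval (t : ℝ) * (p j).eval (t : ℝ) ∂ρ = if i = j then 1 else 0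
  zero_eq : p 0 = 1

/-- The product polynomial `P_ν(y) = ∏_{m ∈ supp ν} P_{ν_m}^m (y_m)`. -/
def prodPoly (p : ℕ → ℕ → Polynomial ℝ) (ν : Idx) (y : Gam) : ℝ :=
  ∏ m ∈ ν.support, (p m (ν m)).eval (y m : ℝ)

/-! ### The Sobolev space with zero boundary values -/

section Sobolev

variable {d : ℕ}

/-- Pairs (function, gradient field) in `L²(D) × L²(D; ℝᵈ)` with the norm
`(‖v‖² + ‖w‖²)^{1/2}`, i.e. the `H¹`-norm if `w` is the weak gradient of `v`. -/
abbrev GraphSpace (D : Set (EuclideanSpace ℝ (Fin d))) : Type :=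
  WithLp 2 (Lp ℝ 2 (volume.restrict D) × Lp (EuclideanSpace ℝ (Fin d)) 2 (volume.restrict D))

/-- The pairs `(φ, ∇φ)` with a test function `φ ∈ C_c^∞(D)`. -/
def testPairs (D : Set (EuclideanSpace ℝ (Fin d))) : Set (GraphSpace D) :=
  {q | ∃ φ : EuclideanSpace ℝ (Fin d) → ℝ,
    ContDiff ℝ ∞ φ ∧ HasCompactSupport φ ∧ tsupport φ ⊆ D ∧
    (q.fst : EuclideanSpace ℝ (Fin d) → ℝ) =ᵐ[volume.restrict D] φ ∧
    (q.snd : EuclideanSpace ℝ (Fin d) → EuclideanSpace ℝ (Fin d))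
      =ᵐ[volume.restrict D] gradient φ}

/-- `H¹₀(D)`, the closure of `C_c^∞(D)` in the `H¹`-norm. A function is stored together with
its weak gradient, which it determines. -/
def H10Submodule (D : Set (EuclideanSpace ℝ (Fin d))) : Submodule ℝ (GraphSpace D) :=
  (Submodule.span ℝ (testPairs D)).topologicalClosure

/-- `H¹₀(D)` as a Hilbert space. -/
abbrev H10 (D : Set (EuclideanSpace ℝ (Fin d))) : Type := ↥(H10Submodule D)

/-- The function underlying an element of `H¹₀(D)`. -/
def H10.val {D : Set (EuclideanSpace ℝ (Fin d))} (v : H10 D) :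
    Lp ℝ 2 (volume.restrict D) :=
  (v : GraphSpace D).fst

/-- The weak gradient of an element of `H¹₀(D)`. -/
def H10.grad {D : Set (EuclideanSpace ℝ (Fin d))} (v : H10 D) :
    Lp (EuclideanSpace ℝ (Fin d)) 2 (volume.restrict D) :=
  (v : GraphSpace D).snd

end Sobolev

/-! ### The parametric model problem -/

/-- The data of the parametric diffusion problem `-div (a ∇u) = f` in `D`, `u = 0` on `∂D`, with
`a(x, y) = a₀(x) + ∑ y_m a_m(x)`, together with the orthonormal polynomials. -/
structure ParametricProblem (d : ℕ) where
  /-- the spatial domain -/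
  D : Set (EuclideanSpace ℝ (Fin d))
  isOpen_D : IsOpen D
  isConnected_D : IsConnected D
  isBounded_D : Bornology.IsBounded D
  /-- the mean field and its bounds -/
  a₀ : EuclideanSpace ℝ (Fin d) → ℝ
  a₀min : ℝ
  a₀max : ℝ
  a₀_meas : AEStronglyMeasurable a₀ (volume.restrict D)
  a₀min_pos : 0 < a₀min
  a₀_bounds : ∀ᵐ x ∂(volume.restrict D), a₀min ≤ a₀ x ∧ a₀ x ≤ a₀max
  /-- the coefficients of the fluctuations; `a m` multiplies the coordinate `y m` -/
  a : ℕ → EuclideanSpace ℝ (Fin d) → ℝ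
  a_memLp : ∀ m, MemLp (a m) ∞ (volume.restrict D)
  /-- `(1 / a₀min) * ∑ ‖a_m‖_{L^∞(D)} < 1` -/
  tau_lt_one : (∑' m, eLpNorm (a m) ∞ (volume.restrict D)) / ENNReal.ofReal a₀min < 1
  /-- the symmetric probability measures on the factors of the parameter domain -/
  ρ : ℕ → Measure (Set.Icc (-1 : ℝ) 1)
  ρ_prob : ∀ m, IsProbabilityMeasure (ρ m)
  ρ_symm : ∀ m, IsSymmetric (ρ m)
  /-- the orthonormal polynomials -/
  p : ℕ → ℕ → Polynomial ℝ
  p_orthonormal : ∀ m, IsOrthonormalPolynomials (ρ m) (p m)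
  /-- the right-hand side `f ∈ L²_π(Γ; H⁻¹(D))`, with `H⁻¹(D)` the dual of `H¹₀(D)` -/
  f : Lp (StrongDual ℝ (H10 D)) 2 (Measure.infinitePi ρ)

namespace ParametricProblem

variable {d : ℕ} (S : ParametricProblem d)

instance (m : ℕ) : IsProbabilityMeasure (S.ρ m) := S.ρ_prob m

/-- The product measure on the parameter domain. -/
def π : Measure Gam := Measure.infinitePi S.ρ

instance : IsProbabilityMeasure S.π := by
  unfold π
  infer_instance

/-- `𝕍 = L²_π(Γ; H¹₀(D))`. -/
abbrev V : Type := Lp (H10 S.D) 2 S.π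

/-- `B₀(u, v) = ∫_Γ ∫_D a₀ ∇u · ∇v dx dπ`. -/
def B₀ (u v : S.V) : ℝ :=
  ∫ y, (∫ x in S.D, S.a₀ x * inner ℝ ((u y).grad x) ((v y).grad x)) ∂S.π

/-- `B(u, v) = B₀(u, v) + ∑_m ∫_Γ ∫_D y_m a_m ∇u · ∇v dx dπ`. -/
def B (u v : S.V) : ℝ :=
  S.B₀ u v + ∑' m : ℕ,
    ∫ y, (∫ x in S.D, (y m : ℝ) * S.a m x * inner ℝ ((u y).grad x) ((v y).grad x)) ∂S.π

/-- `F(v) = ∫_Γ ⟨f(y), v(y)⟩ dπ`. -/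
def F (v : S.V) : ℝ := ∫ y, (S.f y) (v y) ∂S.π

/-- The multivariate orthonormal polynomials. -/
def P (ν : Idx) (y : Gam) : ℝ := prodPoly S.p ν y

theorem continuous_P (ν : Idx) : Continuous (S.P ν) := by
  unfold P prodPoly
  fun_prop

theorem memLp_smul_P (w : H10 S.D) (ν : Idx) :
    MemLp (fun y => S.P ν y • w) 2 S.π := by
  obtain ⟨C, hC⟩ := (isCompact_range (S.continuous_P ν)).isBounded.exists_norm_le
  refine MemLp.of_bound
    ((S.continuous_P ν).aestronglyMeasurable.smul_const w) (C * ‖w‖) (Eventually.of_forall fun y => ?_)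
  rw [norm_smul]
  exact mul_le_mul_of_nonneg_right (hC _ ⟨y, rfl⟩) (norm_nonneg w)

/-- The product `w P_ν ∈ 𝕍` of `w ∈ H¹₀(D)` and `P_ν`. -/
def tensor (w : H10 S.D) (ν : Idx) : S.V := (S.memLp_smul_P w ν).toLp

end ParametricProblem

/-! ### Meshes and finite element spaces -/

/-- A mesh of `D`: a conforming triangulation of (the closure of) `D` into finitely many compact
non-degenerate simplices. The complex also records the lower-dimensional faces of the elements. -/
structure Mesh {d : ℕ} (D : Set (EuclideanSpace ℝ (Fin d))) where
  complex : Geometry.SimplicialComplex ℝ (EuclideanSpace ℝ (Fin d))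
  finite_faces : complex.faces.Finite
  cover : ⋃ T ∈ {T ∈ complex.faces | T.card = d + 1},
    convexHull ℝ (T : Set (EuclideanSpace ℝ (Fin d))) = closure D

namespace Mesh

variable {d : ℕ} {D : Set (EuclideanSpace ℝ (Fin d))}

/-- The elements of the mesh as compact subsets of `ℝᵈ`: the full-dimensional simplices. -/
def elements (𝒯 : Mesh D) : Set (Set (EuclideanSpace ℝ (Fin d))) :=
  {K | ∃ T ∈ 𝒯.complex.faces, T.card = d + 1 ∧ K = convexHull ℝ (T : Set _)}

/-- `𝒯'` is a refinement of `𝒯`: every element of `𝒯'` lies in an element of `𝒯`. -/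
def IsRefinement (𝒯' 𝒯 : Mesh D) : Prop :=
  ∀ K' ∈ 𝒯'.elements, ∃ K ∈ 𝒯.elements, K' ⊆ K

/-- The functions in `H¹₀(D)` whose restriction to each element of the mesh is affine. -/
def feSpace (𝒯 : Mesh D) : Submodule ℝ (H10 D) where
  carrier := {v | ∀ K ∈ 𝒯.elements, ∃ (g : EuclideanSpace ℝ (Fin d)) (c : ℝ),
    ∀ᵐ x ∂(volume.restrict D), x ∈ K → v.val x = inner ℝ g x + c}
  zero_mem' := by
    intro K _
    refine ⟨0, 0, ?_⟩
    have h : (0 : H10 D).val = 0 := rfl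
    rw [h]
    filter_upwards [Lp.coeFn_zero ℝ 2 (volume.restrict D)] with x hx _
    rw [hx, inner_zero_left, add_zero, Pi.zero_apply]
  add_mem' := by
    intro v w hv hw K hK
    obtain ⟨g, c, h⟩ := hv K hK
    obtain ⟨g', c', h'⟩ := hw K hK
    refine ⟨g + g', c + c', ?_⟩
    have e : (v + w).val = v.val + w.val := rfl
    rw [e]
    filter_upwards [h, h', Lp.coeFn_add v.val w.val] with x h1 h2 h3 hx
    rw [h3, Pi.add_apply, h1 hx, h2 hx, inner_add_left]
    ring
  smul_mem' := by
    intro r v hv K hK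
    obtain ⟨g, c, h⟩ := hv K hK
    refine ⟨r • g, r * c, ?_⟩
    have e : (r • v).val = r • v.val := rfl
    rw [e]
    filter_upwards [h, Lp.coeFn_smul r v.val] with x h1 h3 hx
    rw [h3, Pi.smul_apply, h1 hx, real_inner_smul_left, smul_eq_mul]
    ring

end Mesh

/-! ### Detail indices -/

/-- The number `M_𝔓` of leading parameters that contain all active parameters of `𝔓`; it is the
largest active parameter if parameters are numbered from `1`, and `0` if there is none. -/
def numActive (𝔓 : Finset Idx) : ℕ := 𝔓.sup fun ν => ν.support.sup fun m => m + 1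

/-- The detail index set of `𝔓`: the indices `ν ± ε_m ∉ 𝔓` for `ν ∈ 𝔓` and `m` among the first
`M_𝔓 + 1` parameters; see `mem_detail`. -/
def detail (𝔓 : Finset Idx) : Finset Idx :=
  ((𝔓 ×ˢ Finset.range (numActive 𝔓 + 1)).biUnion fun q =>
    {q.1 + Finsupp.single q.2 1, q.1 - Finsupp.single q.2 1}) \ 𝔓

theorem mem_detail (𝔓 : Finset Idx) (μ : Idx) :
    μ ∈ detail 𝔓 ↔ μ ∉ 𝔓 ∧ ∃ ν ∈ 𝔓, ∃ m, m < numActive 𝔓 + 1 ∧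
      (μ = ν + Finsupp.single m 1 ∨ μ + Finsupp.single m 1 = ν) := by
  simp only [detail, Finset.mem_sdiff, Finset.mem_biUnion, Finset.mem_product, Finset.mem_range,
    Finset.mem_insert, Finset.mem_singleton, Prod.exists]
  constructor
  · rintro ⟨⟨ν, m, ⟨hν, hm⟩, h⟩, hμ⟩
    refine ⟨hμ, ν, hν, m, hm, ?_⟩
    rcases h with h | h
    · exact Or.inl h
    · right
      by_cases h0 : ν m = 0
      · exfalso
        apply hμ
        have : μ = ν := by
          rw [h]
          ext i
          by_cases hi : m = i
          · subst hi
            simp [h0]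
          · simp [hi]
        rwa [this]
      · rw [h]
        ext i
        by_cases hi : m = i
        · subst hi
          simp
          omega
        · simp [hi]
  · rintro ⟨hμ, ν, hν, m, hm, h⟩
    refine ⟨⟨ν, m, ⟨hν, hm⟩, ?_⟩, hμ⟩
    rcases h with h | h
    · exact Or.inl h
    · right
      rw [← h]
      simp

/-! ### Galerkin discretization, error indicators, and the adaptive loop -/

namespace ParametricProblem

variable {d : ℕ} (S : ParametricProblem d)

/-- The discrete space `𝕏_• ⊗ ℙ_•`, spanned by the products `w P_ν` with `w ∈ 𝕏_•`, `ν ∈ 𝔓_•`. -/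
def discreteSpace (𝒯 : Mesh S.D) (𝔓 : Finset Idx) : Submodule ℝ S.V :=
  Submodule.span ℝ {v | ∃ w ∈ 𝒯.feSpace, ∃ ν ∈ 𝔓, v = S.tensor w ν}

/-- `u` is the Galerkin solution in the discrete space of `𝒯` and `𝔓`. -/
def IsGalerkinSolution (𝒯 : Mesh S.D) (𝔓 : Finset Idx) (u : S.V) : Prop :=
  u ∈ S.discreteSpace 𝒯 𝔓 ∧ ∀ v ∈ S.discreteSpace 𝒯 𝔓, S.B u v = S.F v

/-- `e` is the hierarchical error function in `𝕏_•` for the index `ν` and the approximation `u`. -/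
def IsErrorFunction (𝒯 : Mesh S.D) (u : S.V) (ν : Idx) (e : H10 S.D) : Prop :=
  e ∈ 𝒯.feSpace ∧ ∀ v ∈ 𝒯.feSpace,
    S.B₀ (S.tensor e ν) (S.tensor v ν) = S.F (S.tensor v ν) - S.B u (S.tensor v ν)

/-- `‖a₀^{1/2} ∇w‖_{L²(D)}`. -/
def energyNorm (w : H10 S.D) : ℝ :=
  √(∫ x in S.D, S.a₀ x * ‖w.grad x‖ ^ 2)

/-- A run of the adaptive algorithm (`ℓ = 0, 1, 2, …`) with arbitrary marking. The mesh of step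
`ℓ + 1` may be any conforming refinement of that of step `ℓ`, for instance the coarsest one by
newest vertex bisection that contains a given set of marked vertices. -/
structure AdaptiveRun where
  /-- the meshes -/
  mesh : ℕ → Mesh S.D
  mesh_refines : ∀ ℓ, (mesh (ℓ + 1)).IsRefinement (mesh ℓ)
  /-- the index sets -/
  index : ℕ → Finset Idx
  index_zero : index 0 = {0}
  /-- the marked indices -/
  marked : ℕ → Finset Idx
  marked_subset : ∀ ℓ, marked ℓ ⊆ detail (index ℓ)
  index_succ : ∀ ℓ, index (ℓ + 1) = index ℓ ∪ marked ℓ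
  /-- the Galerkin solutions -/
  u : ℕ → S.V
  u_galerkin : ∀ ℓ, S.IsGalerkinSolution (mesh ℓ) (index ℓ) (u ℓ)
  /-- the hierarchical error functions `e_ℓ^ν`, `ν` a detail index of step `ℓ` -/
  e : ℕ → Idx → H10 S.D
  e_spec : ∀ ℓ, ∀ ν ∈ detail (index ℓ), S.IsErrorFunction (mesh ℓ) (u ℓ) ν (e ℓ ν)

variable {S}

/-- The parametric error indicator `η_ℓ(ν) = ‖a₀^{1/2} ∇e_ℓ^ν‖_{L²(D)}`. -/
def AdaptiveRun.eta (R : S.AdaptiveRun) (ℓ : ℕ) (ν : Idx) : ℝ := S.energyNorm (R.e ℓ ν)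

/-- `η_ℓ(𝔐) = (∑_{ν ∈ 𝔐} η_ℓ(ν)²)^{1/2}` for a set `𝔐` of detail indices. -/
def AdaptiveRun.etaSet (R : S.AdaptiveRun) (ℓ : ℕ) (𝔐 : Finset Idx) : ℝ :=
  √(∑ ν ∈ 𝔐, R.eta ℓ ν ^ 2)

end ParametricProblem

end SGFEM

end

/-!
The proof separates a statement about Galerkin methods in Hilbert spaces from the facts about the
parametric diffusion problem that make it applicable.

The Galerkin solutions `u_ℓ` in the nested discrete spaces converge to some `u_∞`, whether or not
the spaces exhaust `𝕍` (`exists_tendsto_galerkin`), so the residuals `r_ℓ = F - B(u_ℓ, ·)`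
converge to `r_∞ = F - B(u_∞, ·)` in the dual of `𝕍`. The maps `w ↦ w P_ν` form an orthogonal
family of isometries of `H¹₀(D)` into `𝕍`, whence the norms of the components `w ↦ r_∞(w P_ν)` are
square summable over all indices `ν` by Bessel's inequality (`sum_norm_comp_sq_le`).
Testing with `w_ℓ = ∑ e_ℓ^ν P_ν`, the sum over `ν` in a set `A_ℓ` of detail indices, gives
`η_ℓ(A_ℓ)² = (r_ℓ - r_∞)(w_ℓ) + ∑ r_∞(e_ℓ^ν P_ν)` with `‖w_ℓ‖ ≤ C η_ℓ(A_ℓ)`. The right-hand side is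
`o(1) η_ℓ(A_ℓ)` if each `ν` leaves the sets `A_ℓ` for good or satisfies `r_∞(e_ℓ^ν P_ν) = 0`
whenever `ν ∈ A_ℓ` (`tendsto_sum_indicators`). The latter holds if `η_ℓ(ν) → 0` along a subsequence, because
then `r_∞(v P_ν) = 0` for all discrete functions `v` (`tendsto_sum_galerkin_indicators`).

This criterion is used twice. Every index is marked at most once, hence `η_ℓ(𝔐_ℓ) → 0`. An index
which is a detail index infinitely often is one from some step on, and is then never marked again.
The marking condition and `η_ℓ(𝔐_ℓ) → 0` show that its indicators tend to zero along the given
subsequence, and the criterion applies to the full sets of detail indices.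

On the side of the problem data, Poincaré's inequality (`exists_norm_sq_le_norm_grad_sq`), the
orthonormality of the product polynomials (`integral_P_mul_P`) and the coercivity of
affine-parametric forms with `τ < 1` (`exists_coercive_parametric_form`) are needed.
-/

noncomputable section

namespace SGFEM

/-! ### Galerkin approximations and orthogonal families in Hilbert spaces -/

section Hilbert

variable {X V ι : Type*} [NormedAddCommGroup X] [InnerProductSpace ℝ X]
  [NormedAddCommGroup V] [InnerProductSpace ℝ V]

/-- Galerkin solutions in nested subspaces converge, even if the union of the subspaces is not
dense. The energies `F (u n)` are monotone and bounded, and their increments control the squared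
distances of the solutions. -/
theorem exists_tendsto_galerkin [CompleteSpace V] (B : V →L[ℝ] V →L[ℝ] ℝ)
    (hsymm : ∀ u v, B u v = B v u) {c : ℝ} (hc : 0 < c) (hcoer : ∀ v, c * ‖v‖ ^ 2 ≤ B v v)
    (F : V →L[ℝ] ℝ) {W : ℕ → Submodule ℝ V} (hW : Monotone W) {u : ℕ → V}
    (hu : ∀ n, u n ∈ W n) (hgal : ∀ n, ∀ v ∈ W n, B (u n) v = F v) :
    ∃ u' : V, Tendsto u atTop (𝓝 u') := by
  have key : ∀ m n, m ≤ n → c * ‖u n - u m‖ ^ 2 ≤ F (u n) - F (u m) := by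
    intro m n hmn
    refine (hcoer _).trans_eq ?_
    have h1 := hgal n _ (hu n)
    have h2 := hgal n _ (hW hmn (hu m))
    have h3 := hgal m _ (hu m)
    have h4 := hsymm (u m) (u n)
    simp only [map_sub, sub_apply]
    linarith
  have hmono : Monotone fun n => F (u n) := by
    intro m n hmn
    have h := key m n hmn
    have : 0 ≤ c * ‖u n - u m‖ ^ 2 := by positivity
    simp only
    linarith
  have hbdd : BddAbove (Set.range fun n => F (u n)) := by
    refine ⟨‖F‖ ^ 2 / c, ?_⟩
    rintro _ ⟨n, rfl⟩
    have h1 : c * ‖u n‖ ^ 2 ≤ F (u n) := (hcoer _).trans_eq (hgal n _ (hu n))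
    have h2 : F (u n) ≤ ‖F‖ * ‖u n‖ := (le_abs_self _).trans (F.le_opNorm _)
    rw [le_div_iff₀ hc]
    rcases (norm_nonneg (u n)).eq_or_lt with h0 | h0
    · rw [← h0, mul_zero] at h2
      nlinarith [sq_nonneg ‖F‖]
    · have h3 : c * ‖u n‖ ≤ ‖F‖ := by
        refine le_of_mul_le_mul_right ?_ h0
        nlinarith
      nlinarith [mul_le_mul_of_nonneg_left h3 (norm_nonneg F), mul_le_mul_of_nonneg_left h2 hc.le]
  obtain ⟨E, hE⟩ : ∃ E, Tendsto (fun n => F (u n)) atTop (𝓝 E) :=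
    ⟨_, tendsto_atTop_ciSup hmono hbdd⟩
  have hle : ∀ n, F (u n) ≤ E := fun n => hmono.ge_of_tendsto hE n
  refine cauchySeq_tendsto_of_complete
    (cauchySeq_of_le_tendsto_0' (fun n => √((E - F (u n)) / c)) ?_ ?_)
  · intro m n hmn
    rw [dist_comm, dist_eq_norm]
    apply Real.le_sqrt_of_sq_le
    rw [le_div_iff₀ hc]
    linarith [key m n hmn, hle n]
  · have : Tendsto (fun n => √((E - F (u n)) / c)) atTop (𝓝 (√((E - E) / c))) :=
      ((tendsto_const_nhds.sub hE).div_const c).sqrt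
    simpa using this

/-- Bessel's inequality for the components `v ↦ r (T i v)` of a functional with respect to an
orthogonal family of isometries. -/
theorem sum_norm_comp_sq_le [CompleteSpace X] {T : ι → X →ₗᵢ[ℝ] V}
    (hT : OrthogonalFamily ℝ (fun _ : ι => X) T) (r : V →L[ℝ] ℝ) (A : Finset ι) :
    ∑ i ∈ A, ‖r ∘L (T i).toContinuousLinearMap‖ ^ 2 ≤ ‖r‖ ^ 2 := by
  set z : ι → X := fun i =>
    (InnerProductSpace.toDual ℝ X).symm (r ∘L (T i).toContinuousLinearMap) with hz
  have hn : ∀ i, ‖r ∘L (T i).toContinuousLinearMap‖ = ‖z i‖ := fun i =>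
    ((InnerProductSpace.toDual ℝ X).symm.norm_map _).symm
  have hr : ∀ i, r (T i (z i)) = ‖z i‖ ^ 2 := by
    intro i
    rw [← real_inner_self_eq_norm_sq]
    conv_rhs => rw [hz]
    rw [InnerProductSpace.toDual_symm_apply]
    rfl
  simp only [hn]
  have h1 : ∑ i ∈ A, ‖z i‖ ^ 2 = r (∑ i ∈ A, T i (z i)) := by
    rw [map_sum]
    exact Finset.sum_congr rfl fun i _ => (hr i).symm
  have h2 := hT.norm_sum z A
  have h3 : r (∑ i ∈ A, T i (z i)) ≤ ‖r‖ * ‖∑ i ∈ A, T i (z i)‖ :=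
    (le_abs_self _).trans (r.le_opNorm _)
  rw [← h1, ← h2] at h3
  rw [← h2]
  nlinarith [norm_nonneg r, norm_nonneg (∑ i ∈ A, T i (z i)),
    sq_nonneg (‖r‖ - ‖∑ i ∈ A, T i (z i)‖)]

/-- If every index leaves the finite sets `A n` for good or has a vanishing term, then the sums
over `A n` of a summable nonnegative family tend to zero. -/
theorem tendsto_sum_of_eventually_notMem {b : ι → ℝ} (hb : Summable b) (hb0 : ∀ i, 0 ≤ b i)
    {A : ℕ → Finset ι} (hA : ∀ i, (∀ᶠ n in atTop, i ∉ A n) ∨ b i = 0) :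
    Tendsto (fun n => ∑ i ∈ A n, b i) atTop (𝓝 0) := by
  have h := tendsto_tsum_of_dominated_convergence (𝓕 := atTop)
    (f := fun n i => (A n : Set ι).indicator b i) (g := fun _ => (0 : ℝ)) hb ?_ ?_
  · rw [tsum_zero] at h
    exact h.congr fun n => (sum_eq_tsum_indicator b (A n)).symm
  · intro i
    rcases hA i with h | h
    · refine tendsto_const_nhds.congr' ?_
      filter_upwards [h] with n hn
      exact (Set.indicator_of_notMem (by simpa using hn) b).symm
    · refine tendsto_const_nhds.congr fun n => ?_
      exact (Set.indicator_apply_eq_zero.mpr fun _ => h).symm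
  · refine Eventually.of_forall fun n i => ?_
    refine (norm_indicator_le_norm_self b i).trans_eq ?_
    rw [Real.norm_of_nonneg (hb0 i)]

/-- Convergence of hierarchical indicators. Let the residuals `r n` converge to `r'`, and let
`a (e n i) (e n i) = r n (T i (e n i))`. The indicators over `A n` tend to zero if every
index leaves the sets `A n` for good or is one on which `r'` does not see the error functions. -/
theorem tendsto_sum_indicators [CompleteSpace X] {T : ι → X →ₗᵢ[ℝ] V}
    (hT : OrthogonalFamily ℝ (fun _ : ι => X) T) (a : X →L[ℝ] X →L[ℝ] ℝ) {c : ℝ} (hc : 0 < c)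
    (hcoer : ∀ v, c * ‖v‖ ^ 2 ≤ a v v) {r : ℕ → V →L[ℝ] ℝ} {r' : V →L[ℝ] ℝ}
    (hr : Tendsto r atTop (𝓝 r')) {A : ℕ → Finset ι} {e : ℕ → ι → X}
    (he : ∀ n, ∀ i ∈ A n, a (e n i) (e n i) = r n (T i (e n i)))
    (hA : ∀ i, (∀ᶠ n in atTop, i ∉ A n) ∨ ∀ n, i ∈ A n → r' (T i (e n i)) = 0) :
    Tendsto (fun n => ∑ i ∈ A n, a (e n i) (e n i)) atTop (𝓝 0) := by
  classical
  -- the component norms of `r'`, set to zero where `r'` does not contribute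
  set b : ι → ℝ := fun i =>
    if ∀ᶠ n in atTop, i ∉ A n then ‖r' ∘L (T i).toContinuousLinearMap‖ else 0 
  have hb_pos : ∀ i, (∀ᶠ n in atTop, i ∉ A n) → b i = ‖r' ∘L (T i).toContinuousLinearMap‖ :=
    fun i h => if_pos h
  have hb_neg : ∀ i, (¬ ∀ᶠ n in atTop, i ∉ A n) → b i = 0 := fun i h => if_neg h
  have hble : ∀ i, b i ^ 2 ≤ ‖r' ∘L (T i).toContinuousLinearMap‖ ^ 2 := by
    intro i
    by_cases h : ∀ᶠ n in atTop, i ∉ A n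
    · rw [hb_pos i h]
    · rw [hb_neg i h, zero_pow two_ne_zero]
      positivity
  have hsum : Summable fun i => b i ^ 2 :=
    Summable.of_nonneg_of_le (fun i => sq_nonneg _) hble
      (summable_of_sum_le (fun i => sq_nonneg _) (sum_norm_comp_sq_le hT r'))
  have hb : Tendsto (fun n => ∑ i ∈ A n, b i ^ 2) atTop (𝓝 0) := by
    refine tendsto_sum_of_eventually_notMem hsum (fun i => sq_nonneg _) fun i => ?_
    by_cases h : ∀ᶠ n in atTop, i ∉ A n
    · exact Or.inl h
    · right
      rw [hb_neg i h, zero_pow two_ne_zero]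
  set δ : ℕ → ℝ := fun n => ‖r n - r'‖ + √(∑ i ∈ A n, b i ^ 2) with hδ
  have hδ0 : ∀ n, 0 ≤ δ n := fun n => by positivity
  have hδlim : Tendsto δ atTop (𝓝 0) := by
    have h := (tendsto_iff_norm_sub_tendsto_zero.mp hr).add hb.sqrt
    simpa using h
  have hbound : ∀ n, ∑ i ∈ A n, a (e n i) (e n i) ≤ δ n ^ 2 / c := by
    intro n
    set s : ℝ := √(∑ i ∈ A n, ‖e n i‖ ^ 2) with hs
    have hs0 : 0 ≤ s := Real.sqrt_nonneg _
    have hs2 : s ^ 2 = ∑ i ∈ A n, ‖e n i‖ ^ 2 :=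
      Real.sq_sqrt (Finset.sum_nonneg fun i _ => sq_nonneg _)
    have hw : ‖∑ i ∈ A n, T i (e n i)‖ = s := by
      rw [hs, ← hT.norm_sum (e n) (A n), Real.sqrt_sq (norm_nonneg _)]
    have h1 : ∑ i ∈ A n, a (e n i) (e n i)
        = (r n - r') (∑ i ∈ A n, T i (e n i)) + ∑ i ∈ A n, r' (T i (e n i)) := by
      rw [map_sum, ← Finset.sum_add_distrib]
      refine Finset.sum_congr rfl fun i hi => ?_
      rw [he n i hi, sub_apply]
      ring
    have h2 : (r n - r') (∑ i ∈ A n, T i (e n i)) ≤ ‖r n - r'‖ * s := by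
      rw [← hw]
      exact (le_abs_self _).trans ((r n - r').le_opNorm _)
    have h3 : ∑ i ∈ A n, r' (T i (e n i)) ≤ √(∑ i ∈ A n, b i ^ 2) * s := by
      refine le_trans (Finset.sum_le_sum fun i hi => ?_)
        (Real.sum_mul_le_sqrt_mul_sqrt (A n) b fun i => ‖e n i‖)
      by_cases h : ∀ᶠ n in atTop, i ∉ A n
      · rw [hb_pos i h]
        exact (le_abs_self _).trans ((r' ∘L (T i).toContinuousLinearMap).le_opNorm (e n i))
      · rw [hb_neg i h, zero_mul]
        exact ((hA i).resolve_left h n hi).le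
    have h4 : ∑ i ∈ A n, a (e n i) (e n i) ≤ δ n * s := by
      rw [h1, hδ]
      linarith
    have h5 : c * s ^ 2 ≤ ∑ i ∈ A n, a (e n i) (e n i) := by
      rw [hs2, Finset.mul_sum]
      exact Finset.sum_le_sum fun i _ => hcoer _
    rw [le_div_iff₀ hc]
    have h6 : c * s ≤ δ n := by
      rcases hs0.eq_or_lt with h0 | h0
      · rw [← h0, mul_zero]
        exact hδ0 n
      · refine le_of_mul_le_mul_right ?_ h0
        nlinarith
    nlinarith [mul_le_mul_of_nonneg_left h6 (hδ0 n)]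
  refine squeeze_zero (fun n => Finset.sum_nonneg fun i _ => ?_) hbound ?_
  · exact le_trans (by positivity) (hcoer _)
  · simpa using (hδlim.pow 2).div_const c

/-- Convergence of hierarchical Galerkin indicators. The Galerkin solutions `u n` converge by
themselves. The indicators over sets `A n` of detail indices tend to zero if every index
leaves the sets `A n` for good or has indicators that tend to zero along a subsequence. In the
second case the limit residual vanishes on all discrete functions of that index. -/
theorem tendsto_sum_galerkin_indicators [CompleteSpace X] [CompleteSpace V]
    (B : V →L[ℝ] V →L[ℝ] ℝ) (hsymm : ∀ u v, B u v = B v u) {c : ℝ} (hc : 0 < c)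
    (hcoer : ∀ v, c * ‖v‖ ^ 2 ≤ B v v) (F : V →L[ℝ] ℝ)
    {W : ℕ → Submodule ℝ V} (hW : Monotone W) {u : ℕ → V} (hu : ∀ n, u n ∈ W n)
    (hgal : ∀ n, ∀ v ∈ W n, B (u n) v = F v)
    {T : ι → X →ₗᵢ[ℝ] V} (hT : OrthogonalFamily ℝ (fun _ : ι => X) T)
    (a : X →L[ℝ] X →L[ℝ] ℝ) {c' : ℝ} (hc' : 0 < c') (hacoer : ∀ v, c' * ‖v‖ ^ 2 ≤ a v v)
    {Y : ℕ → Submodule ℝ X} (hY : Monotone Y) {Q A : ℕ → Finset ι} (hAQ : ∀ n, A n ⊆ Q n)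
    {e : ℕ → ι → X} (heY : ∀ n, ∀ i ∈ Q n, e n i ∈ Y n)
    (he : ∀ n, ∀ i ∈ Q n, ∀ v ∈ Y n, a (e n i) v = F (T i v) - B (u n) (T i v))
    (hA : ∀ i, (∀ᶠ n in atTop, i ∉ A n) ∨ ∃ s : ℕ → ℕ, StrictMono s ∧
      (∀ᶠ k in atTop, i ∈ Q (s k)) ∧
      Tendsto (fun k => a (e (s k) i) (e (s k) i)) atTop (𝓝 0)) :
    Tendsto (fun n => ∑ i ∈ A n, a (e n i) (e n i)) atTop (𝓝 0) := by
  obtain ⟨u', hu'⟩ := exists_tendsto_galerkin B hsymm hc hcoer F hW hu hgal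
  have hr : Tendsto (fun n => F - B (u n)) atTop (𝓝 (F - B u')) :=
    tendsto_const_nhds.sub ((B.continuous.tendsto u').comp hu')
  refine tendsto_sum_indicators hT a hc' hacoer hr (fun n i hi => ?_) fun i => ?_
  · rw [he n i (hAQ n hi) _ (heY n i (hAQ n hi)), sub_apply]
  refine (hA i).imp_right ?_
  rintro ⟨s, hs, hmem, hlim⟩ n hi
  -- on `v = e n i` the residuals along the subsequence tend to zero, and to the limit residual
  set v : X := e n i
  have hvn : v ∈ Y n := heY n i (hAQ n hi)
  have h1 : Tendsto (fun k => (F - B (u (s k))) (T i v)) atTop (𝓝 ((F - B u') (T i v))) :=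
    ((ContinuousLinearMap.apply ℝ ℝ (T i v)).continuous.tendsto _).comp (hr.comp hs.tendsto_atTop)
  have h2 : Tendsto (fun k => e (s k) i) atTop (𝓝 0) := by
    rw [tendsto_zero_iff_norm_tendsto_zero]
    refine squeeze_zero (fun k => norm_nonneg _)
      (g := fun k => √(a (e (s k) i) (e (s k) i) / c')) (fun k => Real.le_sqrt_of_sq_le ?_)
      (by simpa using (hlim.div_const c').sqrt)
    rw [le_div_iff₀ hc']
    linarith [hacoer (e (s k) i)]
  have h3 : Tendsto (fun k => a (e (s k) i) v) atTop (𝓝 0) := by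
    have h4 := ((a.flip v).continuous.tendsto 0).comp h2
    rw [map_zero] at h4
    exact h4
  refine tendsto_nhds_unique h1 (h3.congr' ?_)
  filter_upwards [hmem, hs.tendsto_atTop.eventually_ge_atTop n] with k hk hkn
  rw [he (s k) i hk v (hY hkn hvn), sub_apply]

end Hilbert

/-! ### The Poincaré inequality -/

section Poincare

variable {d : ℕ}

/-- The squared `L²`-norm as an integral. -/
theorem norm_sq_eq_integral {α E : Type*} [MeasurableSpace α] {μ : Measure α}
    [NormedAddCommGroup E] [InnerProductSpace ℝ E] (f : Lp E 2 μ) :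
    ‖f‖ ^ 2 = ∫ x, ‖f x‖ ^ 2 ∂μ := by
  rw [← real_inner_self_eq_norm_sq, L2.inner_def]
  simp only [real_inner_self_eq_norm_sq]

theorem integrable_norm_sq {α E : Type*} [MeasurableSpace α] {μ : Measure α}
    [NormedAddCommGroup E] [InnerProductSpace ℝ E] (f : Lp E 2 μ) :
    Integrable (fun x => ‖f x‖ ^ 2) μ :=
  (L2.integrable_inner (𝕜 := ℝ) f f).congr
    (Eventually.of_forall fun x => real_inner_self_eq_norm_sq (f x))

/-- Poincaré's inequality for a test function: integrate `φ² = φ² ∂ₑ⟨e, x⟩` by parts for a unit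
vector `e`. -/
theorem integral_sq_le_of_tsupport_subset_closedBall (hd : d ≠ 0)
    {φ : EuclideanSpace ℝ (Fin d) → ℝ} (hφ : ContDiff ℝ ∞ φ) (hc : HasCompactSupport φ) {ρ : ℝ}
    (hρ : tsupport φ ⊆ Metric.closedBall 0 ρ) :
    ∫ x, φ x ^ 2 ≤ 4 * ρ ^ 2 * ∫ x, ‖gradient φ x‖ ^ 2 := by
  have : NeZero d := ⟨hd⟩
  set e : EuclideanSpace ℝ (Fin d) := EuclideanSpace.single 0 1 with he
  have he1 : ‖e‖ = 1 := by simp [he]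
  have hdiff : Differentiable ℝ φ := hφ.differentiable (by simp)
  have hcont : Continuous φ := hφ.continuous
  have hfd : Continuous (fderiv ℝ φ) := hφ.continuous_fderiv (by simp)
  have hgn : ∀ x, ‖gradient φ x‖ = ‖fderiv ℝ φ x‖ := fun x => by
    rw [gradient, LinearIsometryEquiv.norm_map]
  have hgd : ∀ x, fderiv ℝ (fun x => inner ℝ e x) x e = 1 := by
    intro x
    have : (fun x => inner ℝ e x) = innerSL ℝ e := by
      ext x
      simp
    rw [this, ContinuousLinearMap.fderiv, innerSL_apply_apply, real_inner_self_eq_norm_sq, he1]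
    norm_num
  have hfd2 : ∀ x, fderiv ℝ (fun x => φ x ^ 2) x e = 2 * φ x * fderiv ℝ φ x e := by
    intro x
    rw [((hdiff x).hasFDerivAt.pow 2).fderiv]
    simp
  have hci : Continuous fun x : EuclideanSpace ℝ (Fin d) => inner ℝ e x := by fun_prop
  have hzero : ∀ x, x ∉ tsupport φ → φ x = 0 := fun x => image_eq_zero_of_notMem_tsupport
  have hzero' : ∀ x, x ∉ tsupport φ → fderiv ℝ φ x = 0 := fun x =>
    fderiv_of_notMem_tsupport ℝ
  have hint : ∀ f : EuclideanSpace ℝ (Fin d) → ℝ, Continuous f →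
      (∀ x, x ∉ tsupport φ → f x = 0) → Integrable f := fun f hf h0 =>
    hf.integrable_of_hasCompactSupport (HasCompactSupport.intro hc h0)
  have i1 : Integrable fun x => φ x ^ 2 :=
    hint _ (hcont.pow 2) fun x hx => by rw [hzero x hx, zero_pow two_ne_zero]
  have i2 : Integrable fun x => ‖fderiv ℝ φ x‖ ^ 2 :=
    hint _ (hfd.norm.pow 2) fun x hx => by rw [hzero' x hx, norm_zero, zero_pow two_ne_zero]
  have i3 : Integrable fun x => fderiv ℝ (fun x => φ x ^ 2) x e * inner ℝ e x := by
    simp only [hfd2]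
    exact hint _ (by fun_prop) fun x hx => by rw [hzero x hx]; ring
  have hibp := integral_mul_fderiv_eq_neg_fderiv_mul_of_integrable (μ := volume)
    (f := fun x => φ x ^ 2) (g := fun x => inner ℝ e x) (v := e) i3
    (by simpa only [hgd, mul_one] using i1)
    (hint _ (by fun_prop) fun x hx => by rw [hzero x hx]; ring)
    (fun x _ => (hdiff x).pow 2) 
    (fun x _ => (differentiableAt_const e).inner ℝ differentiableAt_id)
  simp only [hgd, mul_one] at hibp
  have hle : ∫ x, φ x ^ 2 ≤ ∫ x, (φ x ^ 2 / 2 + 2 * ρ ^ 2 * ‖fderiv ℝ φ x‖ ^ 2) := by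
    rw [hibp, ← integral_neg]
    refine integral_mono i3.neg ((i1.div_const 2).add (i2.const_mul _)) fun x => ?_
    simp only [hfd2]
    by_cases hx : x ∈ tsupport φ
    · have hxρ : |inner ℝ e x| ≤ ρ := by
        refine (abs_real_inner_le_norm e x).trans ?_
        rw [he1, one_mul]
        simpa using hρ hx
      have hD : |fderiv ℝ φ x e| ≤ ‖fderiv ℝ φ x‖ := by
        simpa [he1] using (fderiv ℝ φ x).le_opNorm e
      have h1 : |fderiv ℝ φ x e * inner ℝ e x| ≤ ‖fderiv ℝ φ x‖ * ρ := by
        rw [abs_mul]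
        exact mul_le_mul hD hxρ (abs_nonneg _) (norm_nonneg _)
      -- `-2 φ t ≤ φ² / 2 + 2 t²` with `t = ∂ₑφ ⟨e, x⟩`, to absorb `φ²` on the left-hand side
      have h2 : (fderiv ℝ φ x e * inner ℝ e x) ^ 2 ≤ (‖fderiv ℝ φ x‖ * ρ) ^ 2 :=
        sq_le_sq.mpr (h1.trans (le_abs_self _))
      nlinarith [sq_nonneg (φ x + 2 * (fderiv ℝ φ x e * inner ℝ e x))]
    · rw [hzero x hx, hzero' x hx]
      simp
  rw [integral_add (i1.div_const 2) (i2.const_mul _), integral_div, integral_const_mul] at hle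
  simp only [hgn]
  linarith

/-- The test pairs already form a linear subspace. -/
theorem span_testPairs_subset (D : Set (EuclideanSpace ℝ (Fin d))) :
    (Submodule.span ℝ (testPairs D) : Set (GraphSpace D)) ⊆ testPairs D := by
  intro q hq
  induction hq using Submodule.span_induction with
  | mem q hq => exact hq
  | zero =>
    refine ⟨0, contDiff_const, HasCompactSupport.zero, by simp, Lp.coeFn_zero _ _ _, ?_⟩
    refine (Lp.coeFn_zero _ _ _).trans (Eventually.of_forall fun x => ?_)
    simp [gradient]
  | add q₁ q₂ _ _ h₁ h₂ =>
    obtain ⟨φ₁, s₁, c₁, t₁, v₁, g₁⟩ := h₁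
    obtain ⟨φ₂, s₂, c₂, t₂, v₂, g₂⟩ := h₂
    refine ⟨φ₁ + φ₂, s₁.add s₂, c₁.add c₂, ?_, ?_, ?_⟩
    · exact (tsupport_add φ₁ φ₂).trans (Set.union_subset t₁ t₂)
    · exact (Lp.coeFn_add q₁.fst q₂.fst).trans (v₁.add v₂)
    · refine (Lp.coeFn_add q₁.snd q₂.snd).trans
        ((g₁.add g₂).trans (Eventually.of_forall fun x => ?_))
      simp only [gradient, Pi.add_apply]
      rw [fderiv_add (s₁.differentiable (by simp) x) (s₂.differentiable (by simp) x), map_add]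
  | smul r q _ h =>
    obtain ⟨φ, s, c, t, v, g⟩ := h
    refine ⟨r • φ, s.const_smul r, c.smul_left (f := fun _ => r), ?_, ?_, ?_⟩
    · exact (tsupport_smul_subset_right (fun _ => r) φ).trans t
    · exact (Lp.coeFn_smul r q.fst).trans (v.const_smul r)
    · refine (Lp.coeFn_smul r q.snd).trans
        ((g.const_smul r).trans (Eventually.of_forall fun x => ?_))
      simp only [gradient, Pi.smul_apply]
      rw [fderiv_const_smul (s.differentiable (by simp) x), map_smul]

/-- Poincaré's inequality on `H¹₀(D)`: the gradient controls the `H¹`-norm. -/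
theorem exists_norm_sq_le_norm_grad_sq (hd : d ≠ 0) {D : Set (EuclideanSpace ℝ (Fin d))}
    (hD : Bornology.IsBounded D) :
    ∃ C : ℝ, 0 < C ∧ ∀ v : H10 D, ‖v‖ ^ 2 ≤ C * ‖v.grad‖ ^ 2 := by
  obtain ⟨ρ, hρ⟩ := hD.subset_closedBall 0
  -- `4 ρ²` bounds the function part and `1` the gradient part of the `H¹`-norm
  refine ⟨4 * ρ ^ 2 + 1, by positivity, fun v => ?_⟩
  have hclosed : IsClosed {q : GraphSpace D | ‖q‖ ^ 2 ≤ (4 * ρ ^ 2 + 1) * ‖q.snd‖ ^ 2} := by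
    have : Continuous fun q : GraphSpace D => q.snd :=
      (WithLp.sndL 2 ℝ (Lp ℝ 2 (volume.restrict D))
        (Lp (EuclideanSpace ℝ (Fin d)) 2 (volume.restrict D))).continuous
    exact isClosed_le (by fun_prop) (by fun_prop)
  refine closure_minimal (s := (Submodule.span ℝ (testPairs D) : Set (GraphSpace D))) ?_ hclosed v.2
  intro q hq
  obtain ⟨φ, hφ, hc, ht, hv, hg⟩ := span_testPairs_subset D hq
  have h1 : ‖q.fst‖ ^ 2 = ∫ x, φ x ^ 2 := by
    rw [norm_sq_eq_integral,
      ← setIntegral_eq_integral_of_forall_compl_eq_zero (s := D) (f := fun x => φ x ^ 2)]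
    · refine integral_congr_ae ?_
      filter_upwards [hv] with x hx
      rw [hx, Real.norm_eq_abs, sq_abs]
    · intro x hx
      rw [image_eq_zero_of_notMem_tsupport fun h => hx (ht h), zero_pow two_ne_zero]
  have h2 : ‖q.snd‖ ^ 2 = ∫ x, ‖gradient φ x‖ ^ 2 := by
    rw [norm_sq_eq_integral,
      ← setIntegral_eq_integral_of_forall_compl_eq_zero (s := D)
        (f := fun x => ‖gradient φ x‖ ^ 2)]
    · refine integral_congr_ae ?_
      filter_upwards [hg] with x hx
      rw [hx]
    · intro x hx
      rw [gradient, fderiv_of_notMem_tsupport ℝ fun h => hx (ht h), map_zero, norm_zero,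
        zero_pow two_ne_zero]
  have h3 := integral_sq_le_of_tsupport_subset_closedBall hd hφ hc (ht.trans hρ)
  rw [Set.mem_ofPred_eq, WithLp.prod_norm_sq_eq_of_L2, h1, h2]
  linarith

end Poincare

/-! ### Bounded bilinear forms on Bochner spaces -/

section Forms

variable {d : ℕ} {D : Set (EuclideanSpace ℝ (Fin d))}

/-- The weak gradient as a bounded operator on `H¹₀(D)`. -/
def gradL (D : Set (EuclideanSpace ℝ (Fin d))) :
    H10 D →L[ℝ] Lp (EuclideanSpace ℝ (Fin d)) 2 (volume.restrict D) :=
  (WithLp.sndL 2 ℝ _ _) ∘L (H10Submodule D).subtypeL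

theorem gradL_apply (v : H10 D) : gradL D v = v.grad := rfl

instance : CompleteSpace (H10 D) :=
  (Submodule.isClosed_topologicalClosure (Submodule.span ℝ (testPairs D))).completeSpace_coe

/-- The bilinear form `(v, w) ↦ ∫_D b ∇v · ∇w dx` on `H¹₀(D)` with a coefficient
`b ∈ L^∞(D)`. -/
def coefForm (b : EuclideanSpace ℝ (Fin d) → ℝ) (hb : MemLp b ∞ (volume.restrict D)) :
    H10 D →L[ℝ] H10 D →L[ℝ] ℝ :=
  (isBoundedBilinearMap_inner (𝕜 := ℝ)
    (E := Lp (EuclideanSpace ℝ (Fin d)) 2 (volume.restrict D))).toContinuousLinearMap.bilinearComp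
    (((ContinuousLinearMap.lsmul ℝ ℝ).holderL (volume.restrict D) ∞ 2 2 (hb.toLp b)) ∘L gradL D)
    (gradL D)

theorem coefForm_apply (b : EuclideanSpace ℝ (Fin d) → ℝ) (hb : MemLp b ∞ (volume.restrict D))
    (v w : H10 D) :
    coefForm b hb v w = ∫ x in D, b x * inner ℝ (v.grad x) (w.grad x) := by
  simp only [coefForm, ContinuousLinearMap.bilinearComp_apply,
    IsBoundedBilinearMap.toContinuousLinearMap_apply, ContinuousLinearMap.comp_apply,
    ContinuousLinearMap.holderL_apply_apply, gradL_apply, L2.inner_def]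
  refine integral_congr_ae ?_
  filter_upwards [(ContinuousLinearMap.lsmul ℝ ℝ).coeFn_holder (r := 2) (hb.toLp b) v.grad,
    hb.coeFn_toLp] with x h1 h2
  rw [h1, h2, ContinuousLinearMap.lsmul_apply, real_inner_smul_left]

theorem coefForm_symm (b : EuclideanSpace ℝ (Fin d) → ℝ) (hb : MemLp b ∞ (volume.restrict D))
    (v w : H10 D) : coefForm b hb v w = coefForm b hb w v := by
  simp only [coefForm_apply, real_inner_comm]

theorem abs_coefForm_le (b : EuclideanSpace ℝ (Fin d) → ℝ) (hb : MemLp b ∞ (volume.restrict D))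
    (v w : H10 D) :
    |coefForm b hb v w| ≤ (eLpNorm b ∞ (volume.restrict D)).toReal * ‖v.grad‖ * ‖w.grad‖ := by
  have h := (ContinuousLinearMap.lsmul ℝ ℝ).norm_holder_apply_apply_le (r := 2) (hb.toLp b) v.grad
  have h1 : ‖ContinuousLinearMap.lsmul ℝ ℝ (E := EuclideanSpace ℝ (Fin d))‖ ≤ 1 :=
    ContinuousLinearMap.opNorm_lsmul_le
  rw [Lp.norm_toLp] at h
  refine (abs_real_inner_le_norm _ _).trans (mul_le_mul_of_nonneg_right (h.trans ?_)
    (norm_nonneg _))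
  refine mul_le_mul_of_nonneg_right ?_ (norm_nonneg _)
  exact mul_le_of_le_one_left ENNReal.toReal_nonneg h1

theorem ae_norm_le_of_memLp_top {α : Type*} [MeasurableSpace α] {μ : Measure α} {f : α → ℝ}
    (hf : MemLp f ∞ μ) : ∀ᵐ x ∂μ, ‖f x‖ ≤ (eLpNorm f ∞ μ).toReal := by
  filter_upwards [ae_le_eLpNormEssSup (f := f) (μ := μ)] with x hx
  rw [← eLpNorm_exponent_top] at hx
  simpa using ENNReal.toReal_mono hf.2.ne hx

theorem le_coefForm_self {b : EuclideanSpace ℝ (Fin d) → ℝ}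
    (hb : MemLp b ∞ (volume.restrict D)) {c : ℝ} (hc : ∀ᵐ x ∂volume.restrict D, c ≤ b x)
    (v : H10 D) : c * ‖v.grad‖ ^ 2 ≤ coefForm b hb v v := by
  rw [norm_sq_eq_integral, coefForm_apply, ← integral_const_mul]
  simp only [real_inner_self_eq_norm_sq]
  refine integral_mono_ae ((integrable_norm_sq v.grad).const_mul c) ?_ ?_
  · exact (integrable_norm_sq v.grad).bdd_mul hb.1
      (ae_norm_le_of_memLp_top hb)
  · filter_upwards [hc] with x hx
    exact mul_le_mul_of_nonneg_right hx (sq_nonneg _)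

variable {α E : Type*} [MeasurableSpace α] {μ : Measure α}
  [NormedAddCommGroup E] [InnerProductSpace ℝ E]

/-- The bilinear form `(u, v) ↦ ∫ φ A(u, v) dμ` on `L²(μ; E)` with a bounded form `A` on `E` and
a weight `φ ∈ L^∞(μ)`. -/
def weightedForm (φ : α → ℝ) (hφ : MemLp φ ∞ μ) (A : E →L[ℝ] E →L[ℝ] ℝ) :
    Lp E 2 μ →L[ℝ] Lp E 2 μ →L[ℝ] ℝ :=
  A.lpPairing μ 2 2 ∘L (ContinuousLinearMap.lsmul ℝ ℝ).holderL μ ∞ 2 2 (hφ.toLp φ)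

theorem weightedForm_apply (φ : α → ℝ) (hφ : MemLp φ ∞ μ) (A : E →L[ℝ] E →L[ℝ] ℝ)
    (u v : Lp E 2 μ) :
    weightedForm φ hφ A u v = ∫ y, φ y * A (u y) (v y) ∂μ := by
  rw [weightedForm, ContinuousLinearMap.comp_apply, ContinuousLinearMap.lpPairing_eq_integral]
  refine integral_congr_ae ?_
  filter_upwards [(ContinuousLinearMap.lsmul ℝ ℝ).coeFn_holder (r := 2) (hφ.toLp φ) u,
    hφ.coeFn_toLp] with y h1 h2
  rw [ContinuousLinearMap.holderL_apply_apply, h1, h2, ContinuousLinearMap.lsmul_apply, map_smul,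
    smul_apply, smul_eq_mul]

theorem abs_weightedForm_le {φ : α → ℝ} (hφ : MemLp φ ∞ μ) (h1 : ∀ y, |φ y| ≤ 1)
    {A : E →L[ℝ] E →L[ℝ] ℝ} {K : ℝ} (hK : 0 ≤ K) (hA : ∀ v w, |A v w| ≤ K * ‖v‖ * ‖w‖)
    (u v : Lp E 2 μ) : |weightedForm φ hφ A u v| ≤ K * ‖u‖ * ‖v‖ := by
  have hA' : ‖A‖ ≤ K := ContinuousLinearMap.opNorm_le_bound₂ _ hK hA
  have h0 : |weightedForm φ hφ A u v| ≤
      ‖A‖ * ‖(ContinuousLinearMap.lsmul ℝ ℝ).holder 2 (hφ.toLp φ) u‖ * ‖v‖ := by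
    refine le_trans ?_ (A.norm_holder_apply_apply_le (r := 1)
      ((ContinuousLinearMap.lsmul ℝ ℝ).holder 2 (hφ.toLp φ) u) v)
    refine le_trans (le_of_eq ?_) (L1.norm_integral_le _)
    rw [weightedForm_apply, L1.integral_eq_integral, Real.norm_eq_abs]
    congr 1
    refine integral_congr_ae ?_
    filter_upwards [(ContinuousLinearMap.lsmul ℝ ℝ).coeFn_holder (r := 2) (hφ.toLp φ) u,
      hφ.coeFn_toLp, A.coeFn_holder (r := 1)
        ((ContinuousLinearMap.lsmul ℝ ℝ).holder 2 (hφ.toLp φ) u) v] with y h1 h2 h3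
    rw [h3, h1, h2, ContinuousLinearMap.lsmul_apply, map_smul, smul_apply, smul_eq_mul]
  refine h0.trans ?_
  have h := (ContinuousLinearMap.lsmul ℝ ℝ).norm_holder_apply_apply_le (r := 2) (hφ.toLp φ) u
  have h2 : ‖ContinuousLinearMap.lsmul ℝ ℝ (E := E)‖ ≤ 1 := ContinuousLinearMap.opNorm_lsmul_le
  have h3 : ‖hφ.toLp φ‖ ≤ 1 := by
    rw [Lp.norm_toLp]
    refine ENNReal.toReal_le_of_le_ofReal zero_le_one ?_
    rw [eLpNorm_exponent_top]
    exact eLpNormEssSup_le_of_ae_bound (Eventually.of_forall h1)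
  have h4 : ‖ContinuousLinearMap.lsmul ℝ ℝ (E := E)‖ * ‖hφ.toLp φ‖ ≤ 1 :=
    by
    nlinarith [norm_nonneg (hφ.toLp φ)]
  have h5 : ‖(ContinuousLinearMap.lsmul ℝ ℝ).holder 2 (hφ.toLp φ) u‖ ≤ ‖u‖ := by
    refine h.trans ?_
    refine (mul_le_mul_of_nonneg_right h4 (norm_nonneg u)).trans_eq (one_mul _)
  have h6 := mul_le_mul hA' h5 (norm_nonneg _) hK
  exact mul_le_mul_of_nonneg_right h6 (norm_nonneg v)

theorem integrable_apply_apply (A : E →L[ℝ] E →L[ℝ] ℝ) (u v : Lp E 2 μ) :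
    Integrable (fun y => A (u y) (v y)) μ :=
  memLp_one_iff_integrable.mp (A.memLp_of_bilin 1 (Lp.memLp u) (Lp.memLp v))

/-- A series of bilinear forms with summable bounds is a bounded bilinear form. -/
theorem exists_hasSum_bilinear {H : Type*} [NormedAddCommGroup H] [NormedSpace ℝ H]
    (b : ℕ → H →L[ℝ] H →L[ℝ] ℝ) {κ : ℕ → ℝ} (hκ : Summable κ)
    (hb : ∀ m u v, |b m u v| ≤ κ m * ‖u‖ * ‖v‖) :
    ∃ B : H →L[ℝ] H →L[ℝ] ℝ, ∀ u v, HasSum (fun m => b m u v) (B u v) := by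
  have hs : ∀ u v, Summable fun m => b m u v := fun u v =>
    Summable.of_norm_bounded ((hκ.mul_right ‖u‖).mul_right ‖v‖) fun m => hb m u v
  refine ⟨(LinearMap.mk₂ ℝ (fun u v => ∑' m, b m u v) ?_ ?_ ?_ ?_).mkContinuous₂ (∑' m, κ m) ?_,
    fun u v => (hs u v).hasSum⟩
  · intro u u' v
    rw [← (hs u v).tsum_add (hs u' v)]
    simp only [map_add, add_apply]
  · intro c u v
    rw [smul_eq_mul, ← tsum_mul_left]
    simp only [map_smul, smul_apply, smul_eq_mul]
  · intro u v v'
    rw [← (hs u v).tsum_add (hs u v')]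
    simp only [map_add]
  · intro c u v
    rw [smul_eq_mul, ← tsum_mul_left]
    simp only [map_smul, smul_eq_mul]
  · intro u v
    rw [← tsum_mul_right, ← tsum_mul_right]
    exact tsum_of_norm_bounded ((hκ.mul_right ‖u‖).mul_right ‖v‖).hasSum fun m => hb m u v

/-- If `f` and `g` are products of scalar functions with fixed vectors, then integrals of bilinear
expressions in `f` and `g` factor. -/
theorem integral_apply_apply_of_ae_eq_smul (A : E →L[ℝ] E →L[ℝ] ℝ) {p q : α → ℝ} {v w : E}
    {f g : α → E} (hf : f =ᵐ[μ] fun y => p y • v) (hg : g =ᵐ[μ] fun y => q y • w) :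
    ∫ y, A (f y) (g y) ∂μ = (∫ y, p y * q y ∂μ) * A v w := by
  rw [← integral_mul_const]
  refine integral_congr_ae ?_
  filter_upwards [hf, hg] with y h1 h2
  rw [h1, h2, map_smul, map_smul, smul_apply, smul_eq_mul, smul_eq_mul]
  ring

theorem inner_of_ae_eq_smul {p q : α → ℝ} {v w : E} {f g : Lp E 2 μ}
    (hf : f =ᵐ[μ] fun y => p y • v) (hg : g =ᵐ[μ] fun y => q y • w) :
    inner ℝ f g = (∫ y, p y * q y ∂μ) * inner ℝ v w := by
  rw [L2.inner_def, ← integral_mul_const]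
  refine integral_congr_ae ?_
  filter_upwards [hf, hg] with y h1 h2
  rw [h1, h2, real_inner_smul_left, real_inner_smul_right]
  ring

theorem integrable_norm_apply_sq {G : Type*} [NormedAddCommGroup G] [NormedSpace ℝ G]
    (L : E →L[ℝ] G) (u : Lp E 2 μ) : Integrable (fun y => ‖L (u y)‖ ^ 2) μ := by
  refine ((integrable_norm_sq u).const_mul (‖L‖ ^ 2)).mono' ?_ (Eventually.of_forall fun y => ?_)
  · exact (L.continuous.comp_aestronglyMeasurable (Lp.aestronglyMeasurable u)).norm.pow 2
  · rw [Real.norm_of_nonneg (sq_nonneg _), ← mul_pow]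
    exact pow_le_pow_left₀ (norm_nonneg _) (L.le_opNorm _) 2

/-- Affine-parametric forms are bounded, symmetric and coercive on `L²(μ; E)`. The main part `A₀`
controls the seminorm `‖L v‖` with constant `a`, the fluctuations `A m` are bounded by `κ m` in
this seminorm, and `∑ κ m < a`. Measuring both in the seminorm keeps the equivalence constant `C`
out of the smallness condition. -/
theorem exists_coercive_parametric_form {G : Type*} [NormedAddCommGroup G] [NormedSpace ℝ G]
    (L : E →L[ℝ] G) {C : ℝ} (hC : 0 < C) (hL : ∀ v, ‖v‖ ^ 2 ≤ C * ‖L v‖ ^ 2)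
    (A₀ : E →L[ℝ] E →L[ℝ] ℝ) {a : ℝ} (hA₀s : ∀ v w, A₀ v w = A₀ w v)
    (hA₀ : ∀ v, a * ‖L v‖ ^ 2 ≤ A₀ v v)
    (A : ℕ → E →L[ℝ] E →L[ℝ] ℝ) (hAs : ∀ m v w, A m v w = A m w v) {κ : ℕ → ℝ}
    (hκ0 : ∀ m, 0 ≤ κ m) (hκ : Summable κ)
    (hκa : ∑' m, κ m < a) (hA : ∀ m v w, |A m v w| ≤ κ m * ‖L v‖ * ‖L w‖)
    {φ : ℕ → α → ℝ} (hφ : ∀ m, MemLp (φ m) ∞ μ) (hφ1 : ∀ m y, |φ m y| ≤ 1) :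
    ∃ B : Lp E 2 μ →L[ℝ] Lp E 2 μ →L[ℝ] ℝ,
      (∀ u v, B u v = ∫ y, A₀ (u y) (v y) ∂μ + ∑' m, ∫ y, φ m y * A m (u y) (v y) ∂μ) ∧
      (∀ u v, B u v = B v u) ∧ ∃ c : ℝ, 0 < c ∧ ∀ u, c * ‖u‖ ^ 2 ≤ B u u := by
  have hA' : ∀ m v w, |A m v w| ≤ κ m * ‖L‖ ^ 2 * ‖v‖ * ‖w‖ := by
    intro m v w
    refine (hA m v w).trans ?_
    have h := mul_le_mul (L.le_opNorm v) (L.le_opNorm w) (norm_nonneg _) (by positivity)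
    nlinarith [mul_le_mul_of_nonneg_left h (hκ0 m)]
  obtain ⟨B₁, hB₁⟩ := exists_hasSum_bilinear (H := Lp E 2 μ)
    (fun m => weightedForm (φ m) (hφ m) (A m)) (hκ.mul_right (‖L‖ ^ 2))
    fun m => abs_weightedForm_le (hφ m) (hφ1 m) (mul_nonneg (hκ0 m) (sq_nonneg _)) (hA' m)
  simp only [weightedForm_apply] at hB₁
  have hB : ∀ u v, (A₀.lpPairing μ 2 2 + B₁) u v =
      ∫ y, A₀ (u y) (v y) ∂μ + ∑' m, ∫ y, φ m y * A m (u y) (v y) ∂μ := by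
    intro u v
    rw [add_apply, add_apply, ContinuousLinearMap.lpPairing_eq_integral, (hB₁ u v).tsum_eq]
  have hsymm : ∀ u v, (A₀.lpPairing μ 2 2 + B₁) u v = (A₀.lpPairing μ 2 2 + B₁) v u := by
    intro u v
    rw [hB, hB]
    refine congrArg₂ (· + ·) (integral_congr_ae (Eventually.of_forall fun y => hA₀s _ _))
      (tsum_congr fun m => integral_congr_ae (Eventually.of_forall fun y => ?_))
    exact congrArg _ (hAs m _ _)
  refine ⟨A₀.lpPairing μ 2 2 + B₁, hB, hsymm, (a - ∑' m, κ m) / C, div_pos (sub_pos.mpr hκa) hC,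
    fun u => ?_⟩
  rw [hB]
  set g : ℝ := ∫ y, ‖L (u y)‖ ^ 2 ∂μ with hg
  have hint := integrable_norm_apply_sq L u
  have h0 : a * g ≤ ∫ y, A₀ (u y) (u y) ∂μ := by
    rw [hg, ← integral_const_mul]
    exact integral_mono (hint.const_mul _) (integrable_apply_apply A₀ u u) fun y => hA₀ (u y)
  have h1 : |∑' m, ∫ y, φ m y * A m (u y) (u y) ∂μ| ≤ (∑' m, κ m) * g := by
    rw [← tsum_mul_right, ← Real.norm_eq_abs]
    refine tsum_of_norm_bounded (hκ.mul_right g).hasSum fun m => ?_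
    rw [hg, ← integral_const_mul]
    refine norm_integral_le_of_norm_le (hint.const_mul _) (Eventually.of_forall fun y => ?_)
    rw [Real.norm_eq_abs, abs_mul, pow_two, ← mul_assoc]
    exact (mul_le_of_le_one_left (abs_nonneg _) (hφ1 m y)).trans (hA m _ _)
  have h2 : ‖u‖ ^ 2 ≤ C * g := by
    rw [norm_sq_eq_integral, hg, ← integral_const_mul]
    exact integral_mono (integrable_norm_sq u) (hint.const_mul C) fun y => hL (u y)
  rw [div_mul_eq_mul_div, div_le_iff₀ hC]
  have h3 := neg_le_of_abs_le h1
  have h4 := mul_le_mul_of_nonneg_left h2 (sub_pos.mpr hκa).le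
  have h5 := mul_le_mul_of_nonneg_left (add_le_add h0 h3) hC.le
  linarith

end Forms

namespace ParametricProblem

variable {d : ℕ} (S : ParametricProblem d)

/-! ### The tensor product polynomials -/

theorem P_eq_prod {ν : Idx} {s : Finset ℕ} (hs : ν.support ⊆ s) (y : Gam) :
    S.P ν y = ∏ m ∈ s, (S.p m (ν m)).eval (y m : ℝ) := by
  refine Finset.prod_subset hs fun m _ hm => ?_
  rw [Finsupp.notMem_support_iff.mp hm, (S.p_orthonormal m).zero_eq, Polynomial.eval_one]

/-- The product polynomials are orthonormal in `L²_π(Γ)`. -/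
theorem integral_P_mul_P (ν μ : Idx) :
    ∫ y, S.P ν y * S.P μ y ∂S.π = if ν = μ then 1 else 0 := by
  classical
  set s : Finset ℕ := ν.support ∪ μ.support with hs
  set q : ℕ → Set.Icc (-1 : ℝ) 1 → ℝ := fun m t =>
    (S.p m (ν m)).eval (t : ℝ) * (S.p m (μ m)).eval (t : ℝ) with hq
  have h1 : ∀ y : Gam, S.P ν y * S.P μ y = ∏ i : s, q i (s.restrict y i) := by
    intro y
    rw [S.P_eq_prod Finset.subset_union_left, S.P_eq_prod Finset.subset_union_right,
      ← Finset.prod_mul_distrib, ← Finset.prod_coe_sort]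
    rfl
  have hcont : Continuous fun z : (i : s) → Set.Icc (-1 : ℝ) 1 => ∏ i : s, q i (z i) := by
    simp only [hq]
    fun_prop
  simp only [h1]
  unfold π
  rw [integral_restrict_infinitePi (μ := S.ρ) (s := s)
    (f := fun z : (i : s) → Set.Icc (-1 : ℝ) 1 => ∏ i : s, q i (z i))
    hcont.aestronglyMeasurable,
    integral_fintype_prod_eq_prod (fun (i : s) t => q i t)]
  simp only [hq, (S.p_orthonormal _).orthonormal]
  by_cases h : ν = μ
  · simp [h]
  · rw [if_neg h]
    obtain ⟨m, hm⟩ : ∃ m, ν m ≠ μ m := by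
      by_contra hcon
      push Not at hcon
      exact h (Finsupp.ext hcon)
    have hms : m ∈ s := by
      rw [hs, Finset.mem_union, Finsupp.mem_support_iff, Finsupp.mem_support_iff]
      omega
    exact Finset.prod_eq_zero (Finset.mem_univ ⟨m, hms⟩) (if_neg hm)

theorem coeFn_tensor (w : H10 S.D) (ν : Idx) :
    (S.tensor w ν : Gam → H10 S.D) =ᵐ[S.π] fun y => S.P ν y • w :=
  (S.memLp_smul_P w ν).coeFn_toLp

theorem inner_tensor (v w : H10 S.D) (ν μ : Idx) :
    inner ℝ (S.tensor v ν) (S.tensor w μ) = if ν = μ then inner ℝ v w else 0 := by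
  refine (inner_of_ae_eq_smul (S.coeFn_tensor v ν) (S.coeFn_tensor w μ)).trans ?_
  rw [S.integral_P_mul_P]
  split_ifs <;> simp

/-- The isometric embedding `w ↦ w P_ν` of `H¹₀(D)` into `𝕍`. -/
def tensorIsometry (ν : Idx) : H10 S.D →ₗᵢ[ℝ] S.V where
  toFun w := S.tensor w ν
  map_add' v w := by
    refine (MemLp.toLp_congr (S.memLp_smul_P (v + w) ν)
      ((S.memLp_smul_P v ν).add (S.memLp_smul_P w ν)) (Eventually.of_forall fun y => ?_)).trans
      (MemLp.toLp_add _ _)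
    exact smul_add _ _ _
  map_smul' c w := by
    refine (MemLp.toLp_congr (S.memLp_smul_P (c • w) ν)
      ((S.memLp_smul_P w ν).const_smul c) (Eventually.of_forall fun y => ?_)).trans
      (MemLp.toLp_const_smul _ _)
    exact smul_comm _ _ _
  norm_map' w := by
    have h := S.inner_tensor w w ν ν
    rw [if_pos rfl, real_inner_self_eq_norm_sq (F := S.V),
      real_inner_self_eq_norm_sq (F := H10 S.D)] at h
    exact (pow_left_inj₀ (norm_nonneg (S.tensor w ν)) (norm_nonneg w) two_ne_zero).mp h

theorem orthogonalFamily_tensorIsometry :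
    OrthogonalFamily (E := S.V) ℝ (fun _ : Idx => H10 S.D) S.tensorIsometry := by
  intro ν μ h v w
  exact (S.inner_tensor v w ν μ).trans (if_neg h)

/-! ### Bounded coercive forms of the parametric problem -/

theorem memLp_a₀ : MemLp S.a₀ ∞ (volume.restrict S.D) := by
  refine memLp_top_of_bound S.a₀_meas S.a₀max ?_
  filter_upwards [S.a₀_bounds] with x hx
  rw [Real.norm_of_nonneg (S.a₀min_pos.le.trans hx.1)]
  exact hx.2

/-- The energy form `(v, w) ↦ ∫_D a₀ ∇v · ∇w dx` on `H¹₀(D)`. -/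
def energyForm : H10 S.D →L[ℝ] H10 S.D →L[ℝ] ℝ := coefForm S.a₀ S.memLp_a₀

theorem le_energyForm (v : H10 S.D) : S.a₀min * ‖v.grad‖ ^ 2 ≤ S.energyForm v v :=
  le_coefForm_self S.memLp_a₀ (S.a₀_bounds.mono fun _ h => h.1) v

theorem energyForm_self_nonneg (v : H10 S.D) : 0 ≤ S.energyForm v v :=
  (mul_nonneg S.a₀min_pos.le (sq_nonneg _)).trans (S.le_energyForm v)

theorem exists_coercive_energyForm (hd : d ≠ 0) :
    ∃ c : ℝ, 0 < c ∧ ∀ v : H10 S.D, c * ‖v‖ ^ 2 ≤ S.energyForm v v := by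
  obtain ⟨C, hC, h⟩ := exists_norm_sq_le_norm_grad_sq hd S.isBounded_D
  refine ⟨S.a₀min / C, div_pos S.a₀min_pos hC, fun v => le_trans ?_ (S.le_energyForm v)⟩
  rw [div_mul_eq_mul_div, div_le_iff₀ hC, mul_assoc, mul_comm _ C]
  exact mul_le_mul_of_nonneg_left (h v) S.a₀min_pos.le

theorem energyNorm_sq (w : H10 S.D) : S.energyNorm w ^ 2 = S.energyForm w w := by
  have h : ∫ x in S.D, S.a₀ x * ‖w.grad x‖ ^ 2 = S.energyForm w w := by
    simp only [energyForm, coefForm_apply, real_inner_self_eq_norm_sq]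
  rw [energyNorm, h, Real.sq_sqrt (S.energyForm_self_nonneg w)]

theorem B₀_eq_integral (u v : S.V) : S.B₀ u v = ∫ y, S.energyForm (u y) (v y) ∂S.π := by
  simp only [B₀, energyForm, coefForm_apply]

theorem B₀_tensor (v w : H10 S.D) (ν : Idx) :
    S.B₀ (S.tensor v ν) (S.tensor w ν) = S.energyForm v w := by
  rw [B₀_eq_integral, integral_apply_apply_of_ae_eq_smul S.energyForm (S.coeFn_tensor v ν)
    (S.coeFn_tensor w ν), S.integral_P_mul_P, if_pos rfl, one_mul]

/-- The right-hand side as a bounded functional on `𝕍`. -/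
def functionalF : S.V →L[ℝ] ℝ :=
  (ContinuousLinearMap.id ℝ (StrongDual ℝ (H10 S.D))).lpPairing (Measure.infinitePi S.ρ) 2 2 S.f

theorem functionalF_apply (v : S.V) : S.functionalF v = S.F v :=
  ContinuousLinearMap.lpPairing_eq_integral _ _ _

/-- The bounds `‖a_m‖_{L^∞(D)}` of the fluctuations. -/
def fluctuationBound (m : ℕ) : ℝ := (eLpNorm (S.a m) ∞ (volume.restrict S.D)).toReal

theorem tsum_eLpNorm_lt :
    ∑' m, eLpNorm (S.a m) ∞ (volume.restrict S.D) < ENNReal.ofReal S.a₀min := by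
  have h := S.tau_lt_one
  rwa [ENNReal.div_lt_iff (Or.inl (by simpa using S.a₀min_pos)) (Or.inl ENNReal.ofReal_ne_top),
    one_mul] at h

theorem summable_fluctuationBound : Summable S.fluctuationBound :=
  ENNReal.summable_toReal (S.tsum_eLpNorm_lt.trans ENNReal.ofReal_lt_top).ne

theorem tsum_fluctuationBound_lt : ∑' m, S.fluctuationBound m < S.a₀min := by
  have h := S.tsum_eLpNorm_lt
  unfold fluctuationBound
  rw [← ENNReal.tsum_toReal_eq fun m => (S.a_memLp m).2.ne]
  exact ENNReal.toReal_lt_of_lt_ofReal h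

theorem memLp_coord (m : ℕ) : MemLp (fun y : Gam => (y m : ℝ)) ∞ S.π := by
  have hc : Continuous fun y : Gam => (y m : ℝ) := by fun_prop
  exact memLp_top_of_bound hc.aestronglyMeasurable 1
    (Eventually.of_forall fun y => abs_le.mpr (y m).2)

/-- The parametric form `B` is a bounded symmetric coercive bilinear form on `𝕍`. -/
theorem exists_coercive_form_eq_B (hd : d ≠ 0) :
    ∃ B : S.V →L[ℝ] S.V →L[ℝ] ℝ, (∀ u v, B u v = S.B u v) ∧ (∀ u v, B u v = B v u) ∧
      ∃ c : ℝ, 0 < c ∧ ∀ u, c * ‖u‖ ^ 2 ≤ B u u := by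
  have hP := exists_norm_sq_le_norm_grad_sq hd S.isBounded_D
  rcases hP with ⟨C, hC, hpoin⟩
  have hform := exists_coercive_parametric_form (μ := S.π) (gradL S.D) hC hpoin
    S.energyForm (coefForm_symm _ S.memLp_a₀) S.le_energyForm
    (fun m => coefForm (S.a m) (S.a_memLp m)) (fun m => coefForm_symm _ (S.a_memLp m))
    (fun m => ENNReal.toReal_nonneg) S.summable_fluctuationBound S.tsum_fluctuationBound_lt
    (fun m => abs_coefForm_le (S.a m) (S.a_memLp m)) S.memLp_coord
    fun m y => abs_le.mpr (y m).2
  rcases hform with ⟨B, hB, hsymm, hcoer⟩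
  have hBeq : ∀ u v, B u v = S.B u v := by
    intro u v
    rw [hB, ParametricProblem.B, B₀_eq_integral]
    simp only [coefForm_apply, mul_assoc, integral_const_mul]
  exact ⟨B, hBeq, hsymm, hcoer⟩

end ParametricProblem

/-! ### Refinement of meshes and index sets -/

theorem Mesh.IsRefinement.feSpace_le {d : ℕ} {D : Set (EuclideanSpace ℝ (Fin d))}
    {𝒯' 𝒯 : Mesh D} (h : 𝒯'.IsRefinement 𝒯) : 𝒯.feSpace ≤ 𝒯'.feSpace := by
  intro v hv K' hK'
  obtain ⟨K, hK, hsub⟩ := h K' hK'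
  obtain ⟨g, c, hgc⟩ := hv K hK
  exact ⟨g, c, hgc.mono fun x hx hxK => hx (hsub hxK)⟩

theorem numActive_mono {𝔓 𝔓' : Finset Idx} (h : 𝔓 ⊆ 𝔓') : numActive 𝔓 ≤ numActive 𝔓' :=
  Finset.sup_mono h

/-- Detail indices persist until they become active. -/
theorem mem_detail_of_subset {𝔓 𝔓' : Finset Idx} (h : 𝔓 ⊆ 𝔓') {μ : Idx} (hμ : μ ∈ detail 𝔓)
    (hμ' : μ ∉ 𝔓') : μ ∈ detail 𝔓' := by
  rw [mem_detail] at hμ ⊢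
  obtain ⟨-, ν, hν, m, hm, hor⟩ := hμ
  exact ⟨hμ', ν, h hν, m, hm.trans_le (Nat.add_le_add_right (numActive_mono h) 1), hor⟩

namespace ParametricProblem

variable {d : ℕ} {S : ParametricProblem d}

theorem discreteSpace_mono {𝒯 𝒯' : Mesh S.D} (h𝒯 : 𝒯.feSpace ≤ 𝒯'.feSpace) {𝔓 𝔓' : Finset Idx}
    (h𝔓 : 𝔓 ⊆ 𝔓') : S.discreteSpace 𝒯 𝔓 ≤ S.discreteSpace 𝒯' 𝔓' := by
  refine Submodule.span_mono ?_
  rintro _ ⟨w, hw, ν, hν, rfl⟩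
  exact ⟨w, h𝒯 hw, ν, h𝔓 hν, rfl⟩

namespace AdaptiveRun

variable (R : S.AdaptiveRun)

theorem feSpace_mono : Monotone fun ℓ => (R.mesh ℓ).feSpace :=
  monotone_nat_of_le_succ fun ℓ => (R.mesh_refines ℓ).feSpace_le

theorem index_mono : Monotone R.index :=
  monotone_nat_of_le_succ fun ℓ => by
    rw [R.index_succ]
    exact Finset.subset_union_left

theorem discreteSpace_mono : Monotone fun ℓ => S.discreteSpace (R.mesh ℓ) (R.index ℓ) :=
  fun _ _ h => ParametricProblem.discreteSpace_mono (R.feSpace_mono h) (R.index_mono h)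

theorem notMem_index_of_mem_detail {ℓ : ℕ} {μ : Idx} (h : μ ∈ detail (R.index ℓ)) :
    μ ∉ R.index ℓ :=
  ((mem_detail _ _).mp h).1

theorem mem_index_of_mem_marked {ℓ k : ℕ} (hk : ℓ < k) {μ : Idx} (h : μ ∈ R.marked ℓ) :
    μ ∈ R.index k := by
  refine R.index_mono (Nat.succ_le_of_lt hk) ?_
  rw [Nat.succ_eq_add_one, R.index_succ]
  exact Finset.mem_union_right _ h

/-- Every index is marked at most once. -/
theorem eventually_notMem_marked (μ : Idx) : ∀ᶠ ℓ in atTop, μ ∉ R.marked ℓ := by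
  by_cases h : ∃ ℓ, μ ∈ R.marked ℓ
  · obtain ⟨ℓ, hℓ⟩ := h
    filter_upwards [eventually_gt_atTop ℓ] with k hk hμ
    exact R.notMem_index_of_mem_detail (R.marked_subset k hμ) (R.mem_index_of_mem_marked hk hℓ)
  · exact Eventually.of_forall fun ℓ hℓ => h ⟨ℓ, hℓ⟩

/-- An index that is a detail index infinitely often is one from some step on. -/
theorem eventually_mem_detail {μ : Idx} (h : ∃ᶠ ℓ in atTop, μ ∈ detail (R.index ℓ)) :
    ∀ᶠ ℓ in atTop, μ ∈ detail (R.index ℓ) := by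
  obtain ⟨ℓ, hℓ⟩ := h.exists
  filter_upwards [eventually_ge_atTop ℓ] with k hk
  obtain ⟨j, hj, hjμ⟩ := (frequently_atTop.mp h) k
  exact mem_detail_of_subset (R.index_mono hk) hℓ
    fun hμ => R.notMem_index_of_mem_detail hjμ (R.index_mono hj hμ)

/-! ### Convergence of the parametric error indicators -/

theorem etaSet_eq (ℓ : ℕ) (𝔐 : Finset Idx) :
    R.etaSet ℓ 𝔐 = √(∑ ν ∈ 𝔐, S.energyForm (R.e ℓ ν) (R.e ℓ ν)) := by
  simp only [etaSet, eta, energyNorm_sq]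

theorem energyForm_e_eq {ℓ : ℕ} {ν : Idx} (hν : ν ∈ detail (R.index ℓ)) {v : H10 S.D}
    (hv : v ∈ (R.mesh ℓ).feSpace) :
    S.energyForm (R.e ℓ ν) v =
      S.functionalF (S.tensor v ν) - S.B (R.u ℓ) (S.tensor v ν) := by
  rw [← S.B₀_tensor _ _ ν, (R.e_spec ℓ ν hν).2 v hv, functionalF_apply]

/-- The indicators over sets of detail indices tend to zero if every index leaves these sets for
good or has indicators that tend to zero along a subsequence. -/
theorem tendsto_etaSet (hd : d ≠ 0) {𝔐 : ℕ → Finset Idx} (h𝔐 : ∀ ℓ, 𝔐 ℓ ⊆ detail (R.index ℓ))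
    (h : ∀ μ, (∀ᶠ ℓ in atTop, μ ∉ 𝔐 ℓ) ∨ ∃ sub : ℕ → ℕ, StrictMono sub ∧
      (∀ᶠ k in atTop, μ ∈ detail (R.index (sub k))) ∧
      Tendsto (fun k => R.eta (sub k) μ) atTop (𝓝 0)) :
    Tendsto (fun ℓ => R.etaSet ℓ (𝔐 ℓ)) atTop (𝓝 0) := by
  have hform := S.exists_coercive_form_eq_B hd
  rcases hform with ⟨B, hB, hsymm, c, hc, hcoer⟩
  have hen := S.exists_coercive_energyForm hd
  rcases hen with ⟨c', hc', hcoer'⟩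
  have hmain : Tendsto (fun ℓ => ∑ ν ∈ 𝔐 ℓ, S.energyForm (R.e ℓ ν) (R.e ℓ ν)) atTop (𝓝 0) := by
    refine tendsto_sum_galerkin_indicators (V := S.V) B hsymm hc hcoer S.functionalF
      R.discreteSpace_mono (fun ℓ => (R.u_galerkin ℓ).1) (fun ℓ v hv => ?_)
      S.orthogonalFamily_tensorIsometry S.energyForm hc' hcoer' R.feSpace_mono h𝔐
      (fun ℓ ν hν => (R.e_spec ℓ ν hν).1) (fun ℓ ν hν v hv => ?_) fun μ => ?_
    · exact (hB _ _).trans (((R.u_galerkin ℓ).2 v hv).trans (S.functionalF_apply v).symm)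
    · exact (R.energyForm_e_eq hν hv).trans (congrArg _ (hB _ _).symm)
    · refine (h μ).imp_right ?_
      rintro ⟨sub, hsub, hmem, heta⟩
      refine ⟨sub, hsub, hmem, ?_⟩
      have h2 := heta.pow 2
      rw [zero_pow two_ne_zero] at h2
      exact h2.congr fun k => S.energyNorm_sq _
  simp only [etaSet_eq]
  have h3 := hmain.sqrt
  rwa [Real.sqrt_zero] at h3

end AdaptiveRun

end ParametricProblem

end SGFEM

end

theorem mainTheorem4 {d : ℕ} (hd : d = 2 ∨ d = 3) (S : SGFEM.ParametricProblem d)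
    (R : S.AdaptiveRun) (g : ℝ → ℝ) (hg : ContinuousOn g (Set.Ici 0))
    (hg_nonneg : ∀ s, 0 ≤ s → 0 ≤ g s) (hg_zero : g 0 = 0)
    (sub : ℕ → ℕ) (hsub : StrictMono sub)
    (hmark : ∀ k, ∀ μ ∈ SGFEM.detail (R.index (sub k)) \ R.marked (sub k),
      R.eta (sub k) μ ≤ g (R.etaSet (sub k) (R.marked (sub k)))) :
    Filter.Tendsto (fun ℓ => R.etaSet ℓ (SGFEM.detail (R.index ℓ))) Filter.atTop (nhds 0) := by
  have hd0 : d ≠ 0 := by omega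
  have hmarked : Tendsto (fun ℓ => R.etaSet ℓ (R.marked ℓ)) atTop (nhds 0) :=
    R.tendsto_etaSet hd0 R.marked_subset fun μ => Or.inl (R.eventually_notMem_marked μ)
  have hgm : Tendsto (fun k => g (R.etaSet (sub k) (R.marked (sub k)))) atTop (nhds 0) := by
    have h0 : Tendsto g (nhdsWithin 0 (Set.Ici 0)) (nhds 0) := by
      have h := hg 0 Set.self_mem_Ici
      rwa [ContinuousWithinAt, hg_zero] at h
    exact h0.comp (tendsto_nhdsWithin_iff.mpr ⟨hmarked.comp hsub.tendsto_atTop,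
      Eventually.of_forall fun k => Real.sqrt_nonneg _⟩)
  refine R.tendsto_etaSet hd0 (fun ℓ => subset_rfl) fun μ => ?_
  by_cases hμ : ∀ᶠ ℓ in atTop, μ ∉ SGFEM.detail (R.index ℓ)
  · exact Or.inl hμ
  · -- `μ` is a detail index for good, hence eventually unmarked, and the marking condition applies
    right
    have hev := R.eventually_mem_detail (μ := μ) (by simpa [Filter.Frequently] using hμ)
    have hsubev := hsub.tendsto_atTop.eventually hev
    refine ⟨sub, hsub, hsubev, squeeze_zero' (Eventually.of_forall fun k => Real.sqrt_nonneg _)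
      ?_ hgm⟩
    filter_upwards [hsubev,
      hsub.tendsto_atTop.eventually (R.eventually_notMem_marked μ)] with k hk hkm
    exact hmark k μ (Finset.mem_sdiff.mpr ⟨hk, hkm⟩)
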